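/- **Paths.** Let $\mathbb V$ be a set of router identifiers. A simple path is a finite sequence of contiguous edges in $\mathbb V\times\mathbb V$ that visits no router twice; $[\,]$ is the trivial path (it visits no router), and $\mathbb P$ is the set of simple paths together with an extra element $\bot$ (no path; no router lies on it). An edge $(i,j)$ is aligned with $p\in\mathbb P$ if $p=[\,]$ or $p$ is a non-trivial path with origin $j$. **Algebras.** A raw routing algebra consists of a set $S$, an operation $\oplus:S\times S\to S$, sets $E_{ij}$ of functions $S\to S$ for all $i,j\in\mathbb V$, elements $\overline 0,\overline\infty\in S$ and functions $f^\infty_{ij}\in E_{ij}$. It is a *routing algebra* if $\oplus$ is selective ($x\oplus y\in\{x,y\}$), associative and commutative, $x\oplus\overline 0=\overline 0=\overline 0\oplus x$, $x\oplus\overline\infty=x=\overline\infty\oplus x$, $f(\overline\infty)=\overline\infty$ for every $f\in E_{ij}$, and $f^\infty_{ij}(x)=\overline\infty$ for all $x$. It is a *path algebra* if it is equipped with $path:S\to\mathbb P$ such that - (P1) $x=\overline\infty\iff path(x)=\bot$; - (P2) $path(\overline 0)=[\,]$; - (P3) for $f\in E_{ij}$ and $x\in S$: if $i\in path(x)$ or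 $(i,j)$ is not aligned with $path(x)$, then $path(f(x))=\bot$; otherwise, if $f(x)\ne\overline\infty$, then $path(f(x))=(i,j)::path(x)$ (in particular this path is simple). **Protocol.** Let $V\subseteq\mathbb V$ be finite. A topology is a matrix $A$ with $A_{ij}\in E_{ij}$ for $i,j\in V$; a network is a family $(N^e)_{e\in\mathbb N}$ of topologies, one for each epoch $e$. States are matrices $X\in S^{V\times V}$; $I$ is the state with $\overline 0$ on the diagonal and $\overline\infty$ elsewhere; $F_A(X)_{ij}=\bigl(\bigoplus_{k\in V}A_{ik}(X_{kj})\bigr)\oplus I_{ij}$. A configuration is a pair $(e,p)$ with $e\in\mathbb N$ and $p\subseteq V$; its participating topology is $A^{ep}_{ij}=N^e_{ij}$ if $i,j\in p$ and $f^\infty_{ij}$ otherwise. A schedule consists of $\alpha:\mathbb N\to 2^V$ (activations), $\beta:\mathbb N\times V\times V\to\mathbb N$ (data flow) with $\beta(t+1,i,j)\le t$, a monotone $\eta:\mathbb N\to\mathbb N$ (epochs) and $\pi:\mathbb N\to 2^V$ (participants); thus messages may be delayed, lost, reordered or duplicated, and the topology and the participants may change with the epoch. Put $\rho(t)=\pi(\eta(t))$.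 The asynchronous state function is $$\delta^t(X)_{ij}=\begin{cases}I_{ij}&\text{if } i\notin\rho(t),\\ X_{ij}&\text{else if } t=0\text{ or } i\notin\rho(t-1),\\ \delta^{t-1}(X)_{ij}&\text{else if } i\notin\alpha(t),\\ F_{A^{\eta(t)\rho(t)}}(L)_{ij}&\text{otherwise, where } L_{kl}=\delta^{\beta(t,i,k)}(X)_{kl}.\end{cases}$$ **Pseudocycles.** $[t_1,t_2]$ (with $t_1\le t_2$) is an expiry period for $i$ if $\eta(t_1)=\eta(t_2)$ and $t_1\le\beta(t,i,j)$ for all $j\in V$ and $t\ge t_2$; an activation period for $i$ if $\eta(t_1)=\eta(t_2)$ and $i\in\alpha(t)$ for some $t\in[t_1,t_2]$ with $t>0$; and a pseudocycle if $\eta(t_1)=\eta(t_2)$ and for every $i\in\rho(t_1)$ there is $t\in[t_1,t_2]$ such that $[t_1,t]$ is an expiry period and $[t,t_2]$ an activation period for $i$. A period contains $k$ pseudocycles if it contains $k$ successive ones that overlap at most in end points. **Freeness.** Write $x\le_\oplus y$ for $x\oplus y=x$. A topology $A$ is free if there are no $m\ge1$, $v_1,\dots,v_m\in V$ and $x_1,\dots,x_m\in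 S$ such that $x_{i-1}\neq\overline\infty$ and $A_{v_iv_{i-1}}(x_{i-1})\le_\oplus x_i$ for all $i$ (indices mod $m$). Let $\mathcal C^{free}$ be the set of configurations $(e,p)$ for which $A^{ep}$ is free. **Theorem.** Let a routing algebra be given that is also a path algebra, a finite set $V\subseteq\mathbb V$ and a network $N$. Then $\delta$ is convergent over $\mathcal C^{free}$: for every $(e,p)\in\mathcal C^{free}$ there are a fixed point $X^*_{ep}$ of $F_{A^{ep}}$ and a number $k^*_{ep}\in\mathbb N$ such that, for every initial state $X$, every schedule and all times $t_1\le t_2$ with $\eta(t_1)=\eta(t_2)$ and $(e,p):=(\eta(t_1),\rho(t_1))\in\mathcal C^{free}$, if $[t_1,t_2]$ contains $k^*_{ep}$ pseudocycles then $\delta^{t_3}(X)=X^*_{ep}$ for every $t_3\ge t_2$ with $\eta(t_3)=\eta(t_2)$. Moreover, for every $(e,p)\in\mathcal C^{free}$ the fixed point of $F_{A^{ep}}$ is unique. -/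

import Mathlib

namespace DBF

universe u v

/-! ### Paths over a set `𝕍` of router identifiers -/

section Paths

variable {𝕍 : Type u}

/-- The routers visited by a sequence of edges: the origin of the first edge, followed by the
destinations of all edges. The trivial path `[]` visits no router. -/
def vertices : List (𝕍 × 𝕍) → List 𝕍
  | [] => []
  | e :: p => e.1 :: e.2 :: p.map Prod.snd

/-- A simple path: consecutive edges are contiguous and no router is visited twice. -/
def IsSimplePath (p : List (𝕍 × 𝕍)) : Prop :=
  p.IsChain (fun e e' => e.2 = e'.1) ∧ (vertices p).Nodup

variable (𝕍) in
/-- The set `ℙ` of simple paths, with an additional element `⊥`, the absence of a path. -/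
abbrev SimplePath : Type u := WithBot {p : List (𝕍 × 𝕍) // IsSimplePath p}

/-- Router `i` lies on the path `P`. No router lies on `⊥` or on the trivial path. -/
def OnPath (i : 𝕍) (P : SimplePath 𝕍) : Prop :=
  ∃ p : {p : List (𝕍 × 𝕍) // IsSimplePath p}, P = (p : SimplePath 𝕍) ∧ i ∈ vertices p.1

/-- `P` is the trivial path. -/
def IsTrivial (P : SimplePath 𝕍) : Prop :=
  ∃ p : {p : List (𝕍 × 𝕍) // IsSimplePath p}, P = (p : SimplePath 𝕍) ∧ p.1 = []

/-- The edge `e` is aligned with `P`: either `P` is trivial, or the destination of `e` is the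
origin of `P`. No edge is aligned with `⊥`. -/
def Aligned (e : 𝕍 × 𝕍) (P : SimplePath 𝕍) : Prop :=
  IsTrivial P ∨
    ∃ p : {p : List (𝕍 × 𝕍) // IsSimplePath p}, P = (p : SimplePath 𝕍) ∧
      ∃ e' q, p.1 = e' :: q ∧ e.2 = e'.1

/-- `Q = e :: P`. As `Q` is an element of `ℙ`, this contains the assertion that `e :: P` is
simple. -/
def IsCons (e : 𝕍 × 𝕍) (P Q : SimplePath 𝕍) : Prop :=
  ∃ p q : {p : List (𝕍 × 𝕍) // IsSimplePath p},
    P = (p : SimplePath 𝕍) ∧ Q = (q : SimplePath 𝕍) ∧ q.1 = e :: p.1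

end Paths

/-! ### Algebras -/

/-- A raw routing algebra `(S, ⊕, E, 0, ∞, f^∞)` over the router identifiers `𝕍`. -/
structure RawRoutingAlgebra (𝕍 : Type u) (S : Type v) where
  /-- the choice operator `⊕` -/
  choice : S → S → S
  /-- `E i j` is the set of policy functions that may be used on the edge `(i, j)` -/
  E : 𝕍 → 𝕍 → Set (S → S)
  /-- the weight of the trivial path -/
  trivial : S
  /-- the invalid path-weight -/
  invalid : S
  /-- the policies that represent the absence of a link -/
  invalidPolicy : (i j : 𝕍) → E i j

variable {𝕍 : Type u} {S : Type v}

/-- The axioms R1-R6 of a routing algebra. -/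
structure IsRoutingAlgebra (R : RawRoutingAlgebra 𝕍 S) : Prop where
  selective : ∀ x y, R.choice x y = x ∨ R.choice x y = y
  assoc : ∀ x y z, R.choice x (R.choice y z) = R.choice (R.choice x y) z
  comm : ∀ x y, R.choice x y = R.choice y x
  trivial_annihilator : ∀ x, R.choice x R.trivial = R.trivial ∧ R.choice R.trivial x = R.trivial
  invalid_identity : ∀ x, R.choice x R.invalid = x ∧ R.choice R.invalid x = x
  invalid_fixed : ∀ i j, ∀ f ∈ R.E i j, f R.invalid = R.invalid
  invalidPolicy_apply : ∀ i j x, (R.invalidPolicy i j : S → S) x = R.invalid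

/-- The axioms P1-P3 of a path algebra. In the last axiom a policy may always filter a weight,
i.e. map it to `∞` (whose path is `⊥`): the constantly invalid policies do so. If it does not,
then the path is extended by the edge. -/
structure IsPathAlgebra (R : RawRoutingAlgebra 𝕍 S) (path : S → SimplePath 𝕍) : Prop where
  path_invalid : ∀ x, x = R.invalid ↔ path x = ⊥
  path_trivial : ∀ x, x = R.trivial → IsTrivial (path x)
  path_reject : ∀ i j, ∀ f ∈ R.E i j, ∀ x,
    (OnPath i (path x) ∨ ¬ Aligned (i, j) (path x)) → path (f x) = ⊥
  path_accept : ∀ i j, ∀ f ∈ R.E i j, ∀ x,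
    ¬ OnPath i (path x) → Aligned (i, j) (path x) → f x ≠ R.invalid →
      IsCons (i, j) (path x) (path (f x))

/-! ### The synchronous iteration. `V` is the finite set of routers that ever participate. -/

section Model

variable (R : RawRoutingAlgebra 𝕍 S) (V : Finset 𝕍)

/-- Adjacency matrices: `A i j` is a policy of the edge `(i, j)`. -/
abbrev Topology : Type (max u v) := (i j : V) → R.E i j

/-- Dynamic networks: one adjacency matrix for each epoch. -/
abbrev Network : Type (max u v) := ℕ → Topology R V

variable (S) in
/-- Global routing states. -/
abbrev State : Type (max u v) := V → V → S

variable {V}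

open Classical in
/-- The identity matrix `I`. -/
noncomputable def identity : State S V :=
  fun i j => if i = j then R.trivial else R.invalid

/-- `A(X) i j = ⨁ k, A i k (X k j)`. The order of the summands does not matter when `⊕` is
associative and commutative, nor does the initial value `∞` when it is an identity. -/
noncomputable def applyTopology (A : Topology R V) (X : State S V) : State S V :=
  fun i j => ((Finset.univ : Finset V).toList.map
    (fun k => (A i k : S → S) (X k j))).foldr R.choice R.invalid

/-- One synchronous round, `F_A(X) = A(X) ⊕ I`. -/
noncomputable def iter (A : Topology R V) (X : State S V) : State S V :=
  fun i j => R.choice (applyTopology R A X i j) (identity R i j)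

open Classical in
/-- The participating topology `A^{ep}` of an epoch `e` and a set `p` of participants. -/
noncomputable def participating (N : Network R V) (c : ℕ × Set V) : Topology R V :=
  fun i j => if i ∈ c.2 ∧ j ∈ c.2 then N c.1 i j else R.invalidPolicy i j

/-! ### Freeness -/

/-- The preference `x ≤ y`: `x` is chosen over `y`. -/
def Preferred (x y : S) : Prop := R.choice x y = x

/-- The assignment `a = (j, y)` threatens the assignment `b = (i, x)` in the topology `A`. -/
def Threatens (A : Topology R V) (a b : V × S) : Prop :=
  Preferred R ((A b.1 a.1 : S → S) a.2) b.2 ∧ a.2 ≠ R.invalid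

/-- A topology is free if there is no cycle of `m + 1 ≥ 1` assignments, each of which threatens
the next one; the addition in `Fin (m + 1)` is modulo `m + 1`. -/
def IsFree (A : Topology R V) : Prop :=
  ¬ ∃ (m : ℕ) (w : Fin (m + 1) → V) (x : Fin (m + 1) → S),
    ∀ i, Threatens R A (w i, x i) (w (i + 1), x (i + 1))

/-- The set of free configurations of the network `N`. -/
def freeConfigs (N : Network R V) : Set (ℕ × Set V) :=
  {c | IsFree R (participating R N c)}

end Model

/-! ### Schedules and the asynchronous iteration. Times and epochs are natural numbers. -/

/-- A schedule `(α, β, η, π)`. Messages may be delayed, lost, reordered and duplicated. -/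
structure Schedule (V : Finset 𝕍) where
  /-- the routers that update at time `t` -/
  α : ℕ → Set V
  /-- `β t i j` is the time at which the information used by `i` at time `t` was sent by `j` -/
  β : ℕ → V → V → ℕ
  /-- the epoch at time `t` -/
  η : ℕ → ℕ
  /-- the participants in epoch `e` -/
  π : ℕ → Set V
  causal : ∀ t i j, β (t + 1) i j ≤ t
  mono : ∀ t₁ t₂, t₁ ≤ t₂ → η t₁ ≤ η t₂

namespace Schedule

variable {V : Finset 𝕍} (s : Schedule V)

/-- The participants at time `t`. -/
def ρ (t : ℕ) : Set V := s.π (s.η t)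

/-- The configuration at time `t`. -/
def config (t : ℕ) : ℕ × Set V := (s.η t, s.ρ t)

/-- `[t₁, t₂]` is an expiry period for `i`. -/
def IsExpiry (i : V) (t₁ t₂ : ℕ) : Prop :=
  t₁ ≤ t₂ ∧ s.η t₁ = s.η t₂ ∧ ∀ (j : V) (t : ℕ), t₂ ≤ t → t₁ ≤ s.β t i j

/-- `[t₁, t₂]` is an activation period for `i`. Time `0` does not count as an activation, since
no router updates its table then: the state at time `0` is the initial one. -/
def IsActivation (i : V) (t₁ t₂ : ℕ) : Prop :=
  s.η t₁ = s.η t₂ ∧ ∃ t, t₁ ≤ t ∧ t ≤ t₂ ∧ 0 < t ∧ i ∈ s.α t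

/-- `[t₁, t₂]` is a pseudocycle. -/
def IsPseudocycle (t₁ t₂ : ℕ) : Prop :=
  t₁ ≤ t₂ ∧ s.η t₁ = s.η t₂ ∧
    ∀ i ∈ s.ρ t₁, ∃ t, t₁ ≤ t ∧ t ≤ t₂ ∧ s.IsExpiry i t₁ t ∧ s.IsActivation i t t₂

/-- `[t₁, t₂]` contains `k` successive pseudocycles `[b 0, e 0], …, [b (k-1), e (k-1)]`, which
overlap at most in their end points. -/
def ContainsPseudocycles (t₁ t₂ k : ℕ) : Prop :=
  ∃ b e : Fin k → ℕ,
    (∀ l, t₁ ≤ b l ∧ e l ≤ t₂ ∧ s.IsPseudocycle (b l) (e l)) ∧ ∀ l l', l < l' → e l ≤ b l'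

end Schedule

section Async

variable (R : RawRoutingAlgebra 𝕍 S) {V : Finset 𝕍}

open Classical in
/-- The asynchronous state function `δ^t(X)`. -/
noncomputable def asyncState (N : Network R V) (s : Schedule V) (X : State S V) :
    ℕ → State S V
  | 0 => fun i j => if i ∉ s.ρ 0 then identity R i j else X i j
  | t + 1 => fun i j =>
      if i ∉ s.ρ (t + 1) then identity R i j
      else if i ∉ s.ρ t then X i j
      else if i ∉ s.α (t + 1) then asyncState N s X t i j
      else iter R (participating R N (s.config (t + 1)))
        (fun k l => asyncState N s X (s.β (t + 1) i k) k l) i j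
termination_by t => t
decreasing_by
  · exact Nat.lt_succ_self t
  · exact Nat.lt_succ_of_le (s.causal t i k)

/-- The protocol on the network `N` is convergent over the set `C` of configurations: there are
fixed points `Xs c` and numbers `k c`, which depend on the configuration only, such that `δ` has
reached `Xs c`, and stays there up to the end of the epoch, after every period within a single
epoch of configuration `c` that contains `k c` pseudocycles. -/
def Convergent (N : Network R V) (C : Set (ℕ × Set V)) : Prop :=
  ∃ (Xs : ℕ × Set V → State S V) (k : ℕ × Set V → ℕ),
    (∀ c ∈ C, iter R (participating R N c) (Xs c) = Xs c) ∧
    ∀ (X : State S V) (s : Schedule V) (t₁ t₂ : ℕ),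
      s.config t₁ ∈ C → t₁ ≤ t₂ → s.η t₁ = s.η t₂ →
      s.ContainsPseudocycles t₁ t₂ (k (s.config t₁)) →
      ∀ t₃, t₂ ≤ t₃ → s.η t₂ = s.η t₃ → asyncState R N s X t₃ = Xs (s.config t₁)

end Async

end DBF

/-! Replace states by boxes: `reach A n` assigns to each pair (router, destination) the weights
possible after `n` rounds in which every input is chosen freely. The boxes decrease with `n`, every
fixed point lies in all of them, and each pseudocycle moves the asynchronous state one box deeper,
whatever the schedule (`asyncState_mem_reach`). So it suffices that the boxes of a free topology
shrink to a single state.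

Each extension puts a new router of `V` on the path, so weights descending from arbitrary initial
data die out after `V.card + 1` rounds. What remains is finite (`reach_finite`), hence the boxes
stabilise. Suppose a stable box for destination `j` has two weights. Its best weight is valid and
extends a weight of a neighbour whose box is not a singleton either, since otherwise the best weight
would be forced. That neighbour's assignment threatens everything in the box, so every ambiguous
assignment is threatened by another one; finiteness yields a cycle, against freeness
(`IsFree.reach_subsingleton`). -/

namespace DBF

universe u v

variable {𝕍 : Type u} {S : Type v} {R : RawRoutingAlgebra 𝕍 S} {V : Finset 𝕍}

/-! ### The preference order -/

namespace IsRoutingAlgebra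

lemma preferred_total (hR : IsRoutingAlgebra R) (x y : S) : Preferred R x y ∨ Preferred R y x := by
  rcases hR.selective x y with h | h
  · exact Or.inl h
  · exact Or.inr ((hR.comm y x).trans h)

lemma preferred_refl (hR : IsRoutingAlgebra R) (x : S) : Preferred R x x :=
  (hR.selective x x).elim id id

lemma preferred_trans (hR : IsRoutingAlgebra R) {x y z : S} (hxy : Preferred R x y)
    (hyz : Preferred R y z) : Preferred R x z := by
  unfold Preferred at *
  rw [← hxy, ← hR.assoc, hyz]

lemma preferred_antisymm (hR : IsRoutingAlgebra R) {x y : S} (hxy : Preferred R x y)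
    (hyx : Preferred R y x) : x = y :=
  hxy.symm.trans ((hR.comm x y).trans hyx)

lemma preferred_invalid (hR : IsRoutingAlgebra R) (x : S) : Preferred R x R.invalid :=
  (hR.invalid_identity x).1

lemma choice_preferred_left (hR : IsRoutingAlgebra R) (x y : S) :
    Preferred R (R.choice x y) x := by
  unfold Preferred
  rw [hR.comm (R.choice x y), hR.assoc, hR.preferred_refl x]

lemma choice_preferred_right (hR : IsRoutingAlgebra R) (x y : S) :
    Preferred R (R.choice x y) y := by
  rw [hR.comm]
  exact hR.choice_preferred_left y x

/-- A finite nonempty set of weights has a most preferred element. -/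
lemma exists_preferred_of_finite (hR : IsRoutingAlgebra R) {B : Set S} (hB : B.Finite)
    (hne : B.Nonempty) : ∃ b ∈ B, ∀ x ∈ B, Preferred R b x := by
  induction B, hB using Set.Finite.induction_on with
  | empty => exact absurd hne Set.not_nonempty_empty
  | @insert a T _ _ ih =>
    rcases T.eq_empty_or_nonempty with rfl | hT
    · refine ⟨a, by simp, fun x hx => ?_⟩
      obtain rfl : x = a := by simpa using hx
      exact hR.preferred_refl x
    · obtain ⟨b, hb, hbT⟩ := ih hT
      rcases hR.preferred_total a b with h | h
      · refine ⟨a, Set.mem_insert _ _, fun x hx => ?_⟩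
        rcases hx with rfl | hx
        · exact hR.preferred_refl x
        · exact hR.preferred_trans h (hbT x hx)
      · refine ⟨b, Set.mem_insert_of_mem _ hb, fun x hx => ?_⟩
        rcases hx with rfl | hx
        · exact h
        · exact hbT x hx

lemma foldr_choice_preferred (hR : IsRoutingAlgebra R) {l : List S} {x : S} (hx : x ∈ l) :
    Preferred R (l.foldr R.choice R.invalid) x := by
  induction l with
  | nil => simp at hx
  | cons a l ih =>
    rw [List.foldr_cons]
    rcases List.mem_cons.1 hx with rfl | hx
    · exact hR.choice_preferred_left _ _
    · exact hR.preferred_trans (hR.choice_preferred_right _ _) (ih hx)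

lemma foldr_choice_mem (hR : IsRoutingAlgebra R) (l : List S) :
    l.foldr R.choice R.invalid = R.invalid ∨ l.foldr R.choice R.invalid ∈ l := by
  induction l with
  | nil => exact Or.inl rfl
  | cons a l ih =>
    rw [List.foldr_cons]
    rcases hR.selective a (l.foldr R.choice R.invalid) with h | h <;> rw [h]
    · exact Or.inr (List.mem_cons_self ..)
    · exact ih.imp_right (List.mem_cons_of_mem _)

/-! ### One synchronous round -/

lemma iter_preferred (hR : IsRoutingAlgebra R) (A : Topology R V) (X : State S V) (i j k : V) :
    Preferred R (iter R A X i j) ((A i k : S → S) (X k j)) := by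
  refine hR.preferred_trans (hR.choice_preferred_left _ _) (hR.foldr_choice_preferred ?_)
  exact List.mem_map.2 ⟨k, by simp, rfl⟩

lemma iter_self (hR : IsRoutingAlgebra R) (A : Topology R V) (X : State S V) (i : V) :
    iter R A X i i = R.trivial := by
  simp [iter, identity, (hR.trivial_annihilator _).1]

/-- Off the diagonal, a valid weight is the extension of a weight of some router. -/
lemma exists_iter_eq (hR : IsRoutingAlgebra R) (A : Topology R V) (X : State S V) {i j : V}
    (hij : i ≠ j) (h : iter R A X i j ≠ R.invalid) :
    ∃ k, iter R A X i j = (A i k : S → S) (X k j) := by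
  have he : iter R A X i j = applyTopology R A X i j := by
    simp [iter, identity, hij, (hR.invalid_identity _).1]
  rw [he] at h ⊢
  rcases hR.foldr_choice_mem ((Finset.univ : Finset V).toList.map
    (fun k => (A i k : S → S) (X k j))) with h' | h'
  · exact absurd h' h
  · obtain ⟨k, -, hk⟩ := List.mem_map.1 h'
    exact ⟨k, hk.symm⟩

/-- A router that does not participate has the corresponding row of the identity matrix. -/
lemma iter_participating_of_notMem (hR : IsRoutingAlgebra R) (N : Network R V) {c : ℕ × Set V}
    {i : V} (hi : i ∉ c.2) (X : State S V) (j : V) :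
    iter R (participating R N c) X i j = identity R i j := by
  by_cases hij : i = j
  · subst hij
    rw [hR.iter_self]
    simp [identity]
  · by_contra h
    have hI : identity R i j = R.invalid := by simp [identity, hij]
    rw [hI] at h
    obtain ⟨k, hk⟩ := hR.exists_iter_eq _ X hij h
    refine h (hk.trans ?_)
    simp [participating, hi, hR.invalidPolicy_apply]

end IsRoutingAlgebra

/-! ### The weights that are reachable after a number of rounds -/

variable (R) in
/-- `reach R A n i j` is the set of weights that router `i` may hold for destination `j` after `n`
rounds, when in each round every router may use any of the possible weights of the others. -/
def reach (A : Topology R V) : ℕ → V → V → Set S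
  | 0 => fun _ _ => Set.univ
  | n + 1 => fun i j =>
      {x | ∃ X : State S V, (∀ k l, X k l ∈ reach A n k l) ∧ iter R A X i j = x}

lemma reach_succ_subset (A : Topology R V) (n : ℕ) (i j : V) :
    reach R A (n + 1) i j ⊆ reach R A n i j := by
  induction n generalizing i j with
  | zero => exact Set.subset_univ _
  | succ n ih =>
    rintro x ⟨X, hX, rfl⟩
    exact ⟨X, fun k l => ih k l (hX k l), rfl⟩

lemma reach_antitone (A : Topology R V) : Antitone (reach R A) :=
  antitone_nat_of_succ_le fun n i j => reach_succ_subset A n i j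

lemma reach_nonempty (A : Topology R V) (n : ℕ) (i j : V) : (reach R A n i j).Nonempty := by
  induction n generalizing i j with
  | zero => exact ⟨R.trivial, trivial⟩
  | succ n ih =>
    choose X hX using ih
    exact ⟨_, X, hX, rfl⟩

/-- This gives uniqueness of the fixed point once the boxes are singletons. -/
lemma mem_reach_of_iter_eq {A : Topology R V} {X : State S V} (hX : iter R A X = X) (n : ℕ)
    (i j : V) : X i j ∈ reach R A n i j := by
  induction n generalizing i j with
  | zero => trivial
  | succ n ih => exact ⟨X, ih, by rw [hX]⟩

variable (R) in
/-- The weights obtained from `0` and `∞` by at most `n` extensions along edges of `A`. -/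
def consistent (A : Topology R V) : ℕ → Set S
  | 0 => {R.trivial, R.invalid}
  | n + 1 => consistent A n ∪ ⋃ i, ⋃ k, (A i k : S → S) '' consistent A n

lemma consistent_finite (A : Topology R V) (n : ℕ) : (consistent R A n).Finite := by
  induction n with
  | zero => exact (Set.finite_singleton _).insert _
  | succ n ih =>
    exact ih.union (Set.finite_iUnion fun i => Set.finite_iUnion fun k => ih.image _)

lemma trivial_mem_consistent (A : Topology R V) (n : ℕ) : R.trivial ∈ consistent R A n := by
  induction n with
  | zero => exact Or.inl rfl
  | succ n ih => exact Or.inl ih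

lemma invalid_mem_consistent (A : Topology R V) (n : ℕ) : R.invalid ∈ consistent R A n := by
  induction n with
  | zero => exact Or.inr rfl
  | succ n ih => exact Or.inl ih

/-- A valid extension of a weight by the edge `(i, k)` has all the routers of the old path on its
path, and additionally the router `i`. -/
lemma IsPathAlgebra.onPath_of_apply {path : S → SimplePath 𝕍} (hP : IsPathAlgebra R path)
    {i k : 𝕍} {f : S → S} (hf : f ∈ R.E i k) {x : S} (hx : f x ≠ R.invalid) :
    ¬ OnPath i (path x) ∧ OnPath i (path (f x)) ∧
      ∀ v, OnPath v (path x) → OnPath v (path (f x)) := by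
  have h : ¬ (OnPath i (path x) ∨ ¬ Aligned (i, k) (path x)) := fun h =>
    hx ((hP.path_invalid _).2 (hP.path_reject i k f hf x h))
  push Not at h
  obtain ⟨p, q, hp, hq, hpq⟩ := hP.path_accept i k f hf x h.1 h.2 hx
  refine ⟨h.1, ⟨q, hq, by simp [hpq, vertices]⟩, ?_⟩
  rintro v ⟨p', hp', hv⟩
  obtain rfl : p = p' := WithBot.coe_injective (hp.symm.trans hp')
  refine ⟨q, hq, ?_⟩
  -- Contiguity of `q` identifies `k` with the origin of a nontrivial `p`, so no router of `p` is
  -- lost.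
  have hc := q.2.1
  rw [hpq] at hc ⊢
  rcases hl : p.1 with _ | ⟨e, l⟩
  · simp [hl, vertices] at hv
  · rw [hl] at hc hv
    have he : k = e.1 := (List.isChain_cons_cons.1 hc).1
    simp only [vertices, List.mem_cons, List.map_cons] at hv ⊢
    rw [he]
    exact Or.inr hv

open Classical in
/-- After `n` rounds, the weights that were not there from the beginning have at least `n` routers
of the network on their paths. -/
lemma mem_consistent_or_le_card {path : S → SimplePath 𝕍} (hR : IsRoutingAlgebra R)
    (hP : IsPathAlgebra R path) (A : Topology R V) (n : ℕ) {i j : V} {x : S}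
    (hx : x ∈ reach R A n i j) :
    x ∈ consistent R A n ∨ n ≤ (V.filter fun v => OnPath v (path x)).card := by
  induction n generalizing i j x with
  | zero => exact Or.inr (Nat.zero_le _)
  | succ n ih =>
    obtain ⟨X, hX, rfl⟩ := hx
    by_cases hij : i = j
    · subst hij
      rw [hR.iter_self]
      exact Or.inl (trivial_mem_consistent A _)
    by_cases hinv : iter R A X i j = R.invalid
    · rw [hinv]
      exact Or.inl (invalid_mem_consistent A _)
    obtain ⟨k, hk⟩ := hR.exists_iter_eq A X hij hinv
    rw [hk] at hinv ⊢
    rcases ih (hX k j) with h | h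
    · exact Or.inl (Or.inr (Set.mem_iUnion.2 ⟨i, Set.mem_iUnion.2 ⟨k, _, h, rfl⟩⟩))
    · obtain ⟨h₁, h₂, h₃⟩ := hP.onPath_of_apply (A i k).2 hinv
      refine Or.inr (Nat.succ_le_of_lt (h.trans_lt (Finset.card_lt_card ?_)))
      -- Strict, because `i` is on the new path but not on the old one.
      refine Finset.ssubset_iff_subset_ne.2 ⟨?_, fun he => h₁ ?_⟩
      · exact Finset.monotone_filter_right _ fun v _ => h₃ v
      · have : (i : 𝕍) ∈ V.filter fun v => OnPath v (path ((A i k : S → S) (X k j))) :=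
          Finset.mem_filter.2 ⟨i.2, h₂⟩
        rw [← he] at this
        exact (Finset.mem_filter.1 this).2

/-- A path cannot contain `V.card + 1` routers of `V`, so only consistent weights survive. -/
lemma reach_finite {path : S → SimplePath 𝕍} (hR : IsRoutingAlgebra R)
    (hP : IsPathAlgebra R path) (A : Topology R V) (i j : V) :
    (reach R A (V.card + 1) i j).Finite := by
  classical
  refine (consistent_finite A (V.card + 1)).subset fun x hx => ?_
  refine (mem_consistent_or_le_card hR hP A _ hx).resolve_right fun h => ?_
  have := h.trans (Finset.card_filter_le _ _)
  omega

/-- A decreasing sequence of sets one of which is finite is eventually constant. -/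
lemma exists_stable_of_antitone {α : Type*} {B : ℕ → Set α} (hB : Antitone B) {m : ℕ}
    (hm : (B m).Finite) : ∃ n, m ≤ n ∧ ∀ n', n ≤ n' → B n' = B n := by
  have hfin : ∀ n, m ≤ n → (B n).Finite := fun n h => hm.subset (hB h)
  -- Minimal cardinality among the finite members: no later set can be smaller.
  obtain ⟨n, hn, hmin⟩ := WellFounded.has_min (measure fun n => (B n).ncard).wf
    {n | m ≤ n} ⟨m, le_refl m⟩
  refine ⟨n, hn, fun n' h => ?_⟩
  exact Set.eq_of_subset_of_ncard_le (hB h) (not_lt.1 (hmin n' (le_trans hn h))) (hfin n hn)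

lemma exists_reach_stable {path : S → SimplePath 𝕍} (hR : IsRoutingAlgebra R)
    (hP : IsPathAlgebra R path) (A : Topology R V) :
    ∃ n, (∀ i j, (reach R A n i j).Finite) ∧ reach R A (n + 1) = reach R A n := by
  have h : ∀ p : V × V, ∃ n, V.card + 1 ≤ n ∧
      ∀ n', n ≤ n' → reach R A n' p.1 p.2 = reach R A n p.1 p.2 := fun p =>
    exists_stable_of_antitone (B := fun n => reach R A n p.1 p.2)
      (fun _ _ h => reach_antitone A h p.1 p.2) (reach_finite hR hP A p.1 p.2)
  choose n hn hstab using h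
  refine ⟨Finset.univ.sup n + (V.card + 1), fun i j => ?_, ?_⟩
  · exact (reach_finite hR hP A i j).subset (reach_antitone A (Nat.le_add_left _ _) i j)
  · funext i j
    have hle : n (i, j) ≤ Finset.univ.sup n := Finset.le_sup (Finset.mem_univ _)
    exact (hstab (i, j) _ (by omega)).trans (hstab (i, j) _ (by omega)).symm

/-! ### Freeness -/

/-- In a free topology a nonempty finite set of assignments has a member that no member
threatens. -/
lemma IsFree.exists_not_threatened {A : Topology R V} (hA : IsFree R A) {T : Set (V × S)}
    (hT : T.Finite) (hne : T.Nonempty) : ∃ b ∈ T, ∀ a ∈ T, ¬ Threatens R A a b := by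
  by_contra! h
  have h' : ∀ b : T, ∃ a : T, Threatens R A a b := fun b =>
    let ⟨a, ha, hab⟩ := h b b.2
    ⟨⟨a, ha⟩, hab⟩
  choose g hg using h'
  have := hT.to_subtype
  obtain ⟨b₀, hb₀⟩ := hne
  obtain ⟨m, n, hmn, heq⟩ : ∃ m n, m < n ∧ g^[m] ⟨b₀, hb₀⟩ = g^[n] ⟨b₀, hb₀⟩ := by
    obtain ⟨m, n, hne, heq⟩ := Finite.exists_ne_map_eq_of_infinite
      (fun n : ℕ => g^[n] ⟨b₀, hb₀⟩)
    rcases lt_or_gt_of_ne hne with h | h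
    · exact ⟨m, n, h, heq⟩
    · exact ⟨n, m, h, heq.symm⟩
  obtain ⟨d, rfl⟩ : ∃ d, n = (d + 1) + m := ⟨n - m - 1, by omega⟩
  set b := g^[m] ⟨b₀, hb₀⟩ with hb
  have hper : g^[d + 1] b = b := by rw [hb, ← Function.iterate_add_apply, ← heq]
  -- The orbit is traversed backwards, as `g` maps an assignment to one that threatens it; `hper`
  -- closes the cycle at `r = d`.
  refine hA ⟨d, fun r => (g^[d - r] b).1.1, fun r => (g^[d - r] b).1.2, fun r => ?_⟩
  have hstep : g^[d - r] b = g (g^[d - (r + 1 : Fin (d + 1))] b) := by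
    rw [← Function.iterate_succ_apply' g]
    rcases eq_or_ne r (Fin.last d) with rfl | hr
    · simpa using hper.symm
    · rw [Fin.val_add_one_of_lt (Fin.lt_last_iff_ne_last.2 hr)]
      have : (r : ℕ) < d := Fin.lt_last_iff_ne_last.2 hr
      congr 2
      omega
  dsimp only
  rw [hstep]
  exact hg _

/-- If the reachable weights of a free topology do not change any more, then they are unique. -/
lemma IsFree.reach_subsingleton (hR : IsRoutingAlgebra R) {A : Topology R V} (hA : IsFree R A)
    {n : ℕ} (hfin : ∀ i j, (reach R A n i j).Finite) (hstab : reach R A (n + 1) = reach R A n)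
    (i j : V) : (reach R A n i j).Subsingleton := by
  by_contra hij
  set T : Set (V × S) :=
    {a | ¬ (reach R A n a.1 j).Subsingleton ∧ a.2 ∈ reach R A n a.1 j}
  have hTfin : T.Finite := by
    refine (Set.finite_iUnion fun k : V => (hfin k j).image (Prod.mk k)).subset ?_
    rintro ⟨k, x⟩ ha
    exact Set.mem_iUnion.2 ⟨k, x, ha.2, rfl⟩
  obtain ⟨x₀, hx₀⟩ := reach_nonempty A n i j
  obtain ⟨⟨k, z⟩, ⟨hk, hz⟩, hnot⟩ := hA.exists_not_threatened hTfin ⟨(i, x₀), hij, hx₀⟩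
  obtain ⟨b, hb, hbest⟩ := hR.exists_preferred_of_finite (hfin k j) (reach_nonempty A n k j)
  obtain ⟨y, hy, hyb⟩ : ∃ y ∈ reach R A n k j, y ≠ b := by
    by_contra! h
    exact hk fun x hx y hy => (h x hx).trans (h y hy).symm
  -- `∞` is least preferred, so it cannot be the best of two distinct weights.
  have hbinv : b ≠ R.invalid := fun h =>
    hyb (hR.preferred_antisymm (h ▸ hR.preferred_invalid y) (hbest y hy))
  rw [← hstab] at hb hy
  obtain ⟨Z, hZ, rfl⟩ := hb
  obtain ⟨Y, hY, rfl⟩ := hy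
  have hkj : k ≠ j := by
    rintro rfl
    exact hyb (by rw [hR.iter_self, hR.iter_self])
  obtain ⟨l, hl⟩ := hR.exists_iter_eq A Z hkj hbinv
  -- If the box of `l` were a singleton, `Y` would offer `k` the same extension through `l`, making
  -- its outcome as good as the best weight.
  refine hnot (l, Z l j) ⟨fun hsub => hyb ?_, hZ l j⟩ ⟨?_, fun h => ?_⟩
  · refine hR.preferred_antisymm ?_ (hbest _ (hstab ▸ ⟨Y, hY, rfl⟩))
    rw [hl, hsub (hZ l j) (hY l j)]
    exact hR.iter_preferred A Y k j l
  · have := hbest z hz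
    rwa [hl] at this
  · dsimp only at h
    rw [h, hR.invalid_fixed _ _ _ (A k l).2] at hl
    exact hbinv hl

/-- In a free topology finitely many rounds leave a single state, which is a fixed point. -/
lemma IsFree.exists_reach_eq_singleton {path : S → SimplePath 𝕍} (hR : IsRoutingAlgebra R)
    (hP : IsPathAlgebra R path) {A : Topology R V} (hA : IsFree R A) :
    ∃ (X : State S V) (n : ℕ), iter R A X = X ∧ ∀ i j, reach R A n i j = {X i j} := by
  obtain ⟨n, hfin, hstab⟩ := exists_reach_stable hR hP A
  choose X hX using reach_nonempty A n
  have hsub := hA.reach_subsingleton hR hfin hstab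
  refine ⟨X, n, ?_, fun i j => (hsub i j).eq_singleton_of_mem (hX i j)⟩
  funext i j
  exact hsub i j (reach_succ_subset A n i j ⟨X, hX, rfl⟩) (hX i j)

/-! ### The asynchronous iteration -/

namespace Schedule

lemma η_eq_of_mem_Icc (s : Schedule V) {a b t : ℕ} (hab : s.η a = s.η b) (ha : a ≤ t)
    (hb : t ≤ b) : s.η t = s.η a :=
  le_antisymm (hab ▸ s.mono _ _ hb) (s.mono _ _ ha)

lemma config_eq_of_η_eq (s : Schedule V) {a b : ℕ} (h : s.η a = s.η b) :
    s.config a = s.config b := by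
  simp [config, ρ, h]

end Schedule

lemma asyncState_of_notMem (N : Network R V) (s : Schedule V) (X : State S V) {t : ℕ} {i : V}
    (hi : i ∉ s.ρ t) (j : V) : asyncState R N s X t i j = identity R i j := by
  cases t <;> simp [asyncState, hi]

/-- If all states from time `b` on are reachable in `n` rounds, and `[b, e]` is a pseudocycle, then
all states from time `e` on are reachable in `n + 1` rounds. -/
lemma asyncState_mem_reach_succ (hR : IsRoutingAlgebra R) (N : Network R V) (s : Schedule V)
    (X : State S V) {b e n : ℕ} (hbe : s.IsPseudocycle b e)
    (h : ∀ t, b ≤ t → s.η t = s.η b → ∀ i j, asyncState R N s X t i j ∈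
      reach R (participating R N (s.config b)) n i j)
    {t : ℕ} (het : e ≤ t) (ht : s.η t = s.η b) (i j : V) :
    asyncState R N s X t i j ∈ reach R (participating R N (s.config b)) (n + 1) i j := by
  obtain ⟨hle, hη, hcyc⟩ := hbe
  have hρ : ∀ t, s.η t = s.η b → s.ρ t = s.ρ b := fun t h => by simp [Schedule.ρ, h]
  by_cases hi : i ∈ s.ρ b
  · obtain ⟨τ, hbτ, hτe, ⟨-, -, hexp⟩, -, τ', hττ', hτ'e, hpos, hact⟩ := hcyc i hi
    have hβ : ∀ t, τ ≤ t + 1 → ∀ k, b ≤ s.β (t + 1) i k ∧ s.β (t + 1) i k ≤ t :=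
      fun t h k => ⟨hexp k _ h, s.causal t i k⟩
    have hupd : ∀ t, τ ≤ t + 1 → s.η (t + 1) = s.η b → i ∈ s.α (t + 1) →
        asyncState R N s X (t + 1) i j ∈
          reach R (participating R N (s.config b)) (n + 1) i j := by
      intro t h₁ h₂ h₃
      -- Hence `t` is in the same epoch, `i` participated already, and the update is not a reset to
      -- `X`.
      have hbt : b ≤ t := (hβ t h₁ i).1.trans (hβ t h₁ i).2
      have hηt : ∀ t', b ≤ t' → t' ≤ t → s.η t' = s.η b := fun t' h h' =>
        s.η_eq_of_mem_Icc h₂.symm h (h'.trans (Nat.le_succ t))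
      refine ⟨fun k l => asyncState R N s X (s.β (t + 1) i k) k l, fun k l => ?_, ?_⟩
      · exact h _ (hβ t h₁ k).1 (hηt _ (hβ t h₁ k).1 (hβ t h₁ k).2) k l
      · rw [asyncState]
        simp only [hρ _ h₂, hρ _ (hηt t hbt le_rfl), hi, h₃, not_true_eq_false, if_false,
          s.config_eq_of_η_eq h₂]
    suffices hall : ∀ t, τ' ≤ t → s.η t = s.η b → asyncState R N s X t i j ∈
        reach R (participating R N (s.config b)) (n + 1) i j from hall t (hτ'e.trans het) ht
    intro t hτt
    -- From the activation `τ'` on, `i` either recomputes from unexpired data or keeps its row.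
    induction t, hτt using Nat.le_induction with
    | base =>
      intro h'
      obtain ⟨r, rfl⟩ : ∃ r, τ' = r + 1 := ⟨τ' - 1, by omega⟩
      exact hupd r hττ' h' hact
    | succ t hτt ih =>
      intro h'
      by_cases ha : i ∈ s.α (t + 1)
      · exact hupd t (by omega) h' ha
      · have hηt : s.η t = s.η b := s.η_eq_of_mem_Icc h'.symm (by omega) (Nat.le_succ t)
        rw [asyncState]
        simp only [hρ _ h', hρ _ hηt, hi, ha, not_true_eq_false, not_false_eq_true, if_false,
          if_true]
        exact ih hηt
  · rw [asyncState_of_notMem N s X (by rwa [hρ t ht])]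
    -- Any state in the boxes serves as witness: the row of `i` does not depend on it.
    exact ⟨asyncState R N s X b, h b le_rfl rfl, hR.iter_participating_of_notMem N hi _ j⟩

/-- After `n` pseudocycles the state is reachable in `n` rounds. -/
lemma asyncState_mem_reach (hR : IsRoutingAlgebra R) (N : Network R V) (s : Schedule V)
    (X : State S V) {t₁ t₂ n : ℕ} (h : s.ContainsPseudocycles t₁ t₂ n)
    (hη : s.η t₁ = s.η t₂) {t : ℕ} (h₁ : t₁ ≤ t) (h₂ : t₂ ≤ t) (ht : s.η t = s.η t₁) (i j : V) :
    asyncState R N s X t i j ∈ reach R (participating R N (s.config t₁)) n i j := by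
  obtain ⟨b, e, hbe, hsucc⟩ := h
  -- For the induction, the claim for `m` must hold from the end of the first `m` pseudocycles on,
  -- not only after `t₂`.
  suffices hall : ∀ m ≤ n, ∀ t, t₁ ≤ t → (∀ l : Fin n, l < m → e l ≤ t) → s.η t = s.η t₁ →
      ∀ i j, asyncState R N s X t i j ∈
        reach R (participating R N (s.config t₁)) m i j from
    hall n le_rfl t h₁ (fun l _ => (hbe l).2.1.trans h₂) ht i j
  intro m
  induction m with
  | zero => exact fun _ t _ _ _ i j => trivial
  | succ m ih =>
    intro hm t ht₁ hte ht i j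
    obtain ⟨hb, he, hcyc⟩ := hbe ⟨m, hm⟩
    have hηb : s.η (b ⟨m, hm⟩) = s.η t₁ := s.η_eq_of_mem_Icc hη hb (hcyc.1.trans he)
    rw [← s.config_eq_of_η_eq hηb]
    refine asyncState_mem_reach_succ hR N s X hcyc (fun t' hbt' ht' => ?_)
      (hte ⟨m, hm⟩ (Nat.lt_succ_self m)) (ht.trans hηb.symm) i j
    rw [s.config_eq_of_η_eq hηb]
    exact ih (by omega) t' (hb.trans hbt') (fun l hl => (hsucc l ⟨m, hm⟩ hl).trans hbt')
      (ht'.trans hηb)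

end DBF

theorem mainTheorem1 {𝕍 : Type*} {S : Type*} (R : DBF.RawRoutingAlgebra 𝕍 S)
    (path : S → DBF.SimplePath 𝕍) (hR : DBF.IsRoutingAlgebra R) (hP : DBF.IsPathAlgebra R path)
    (V : Finset 𝕍) (N : DBF.Network R V) :
    DBF.Convergent R N (DBF.freeConfigs R N) ∧
      ∀ c ∈ DBF.freeConfigs R N,
        ∃! X : DBF.State S V, DBF.iter R (DBF.participating R N c) X = X := by
  have h : ∀ c, ∃ (X : DBF.State S V) (n : ℕ), c ∈ DBF.freeConfigs R N →
      DBF.iter R (DBF.participating R N c) X = X ∧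
        ∀ i j, DBF.reach R (DBF.participating R N c) n i j = {X i j} := by
    intro c
    by_cases hc : c ∈ DBF.freeConfigs R N
    · obtain ⟨X, n, hX⟩ := DBF.IsFree.exists_reach_eq_singleton hR hP hc
      exact ⟨X, n, fun _ => hX⟩
    -- Dummy values outside the free configurations.
    · exact ⟨fun _ _ => R.trivial, 0, fun h => absurd h hc⟩
  choose Xs k hXs using h
  refine ⟨⟨Xs, k, fun c hc => (hXs c hc).1, ?_⟩, fun c hc => ⟨Xs c, (hXs c hc).1, ?_⟩⟩
  · intro X s t₁ t₂ hc hle hη hcyc t₃ ht₃ hη₃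
    funext i j
    have hmem := DBF.asyncState_mem_reach hR N s X hcyc hη (hle.trans ht₃) ht₃
      (hη.trans hη₃).symm i j
    rwa [(hXs _ hc).2] at hmem
  · intro Y hY
    funext i j
    have hmem := DBF.mem_reach_of_iter_eq hY (k c) i j
    rwa [(hXs c hc).2] at hmem
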